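/- Let $G$ be a countably infinite amenable group. A Følner sequence of $G$ is a sequence $(F_n)$ of nonempty finite subsets of $G$ with $|B(F_n,K)|/|F_n|\to 0$ for every nonempty finite $K\subseteq G$, where $B(F,K)=\{g\in G: Kg\cap F\neq\emptyset \text{ and } Kg\cap (G\setminus F)\neq\emptyset\}$. For $J\subseteq G$ put $$\delta(J)=\sup_{(F_n)}\limsup_{n\to\infty}\frac{|J\cap F_n|}{|F_n|},$$ the supremum being over all Følner sequences of $G$. Let $P$ be a polyhedron (a space homeomorphic to a finite simplicial complex) with a compatible metric $d$, let $G$ act on $P^G$ by $(hx)_g=x_{gh}$, and let $X\subseteq P^G$ be a subshift, that is, a closed $G$-invariant subset. For a compatible metric $\rho$ on $X$ and a nonempty finite $F\subseteq G$ put $\rho_F(x,y)=\max_{g\in F}\rho(gx,gy)$. For a compatible metric $\sigma$ on $X$ and $\epsilon>0$ let $\dim_\epsilon(X,\sigma)$ be the minimum of the covering dimensions $\dim Q$ over all compact metric spaces $Q$ for which there is a continuous map $\varphi:X\to Q$ such that $\varphi(x)=\varphi(y)$ implies $\sigma(x,y)\le\epsilon$. The mean topological dimension is $$\mathrm{mdim}(X,G)=\lim_{\epsilon\to0}\,\lim_{n\to\infty}\frac{\dim_\epsilon(X,\rho_{F_n})}{|F_n|},$$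 for a Følner sequence $(F_n)$ of $G$; the limits exist, and the value depends neither on $(F_n)$ nor on $\rho$. Suppose there are a subset $J\subseteq G$ and a point $x_0\in X$ such that: 1. there are sets $W_g\subseteq P$ $(g\in G)$ with $\prod_{g\in G}W_g\subseteq X$ and $\pi_{G\setminus J}(x_0)\in\pi_{G\setminus J}\big(\prod_{g\in G}W_g\big)$, where $\pi_{G\setminus J}:P^G\to P^{G\setminus J}$ is the projection; 2. there is a number $c>0$ such that for each $g\in J$ there is a continuous map $f_g:P\to W_g$ with $d(x,y)\le c\cdot d(f_g(x),f_g(y))$ for all $x,y\in P$. Then $$\mathrm{mdim}(X,G)\ge\delta(J)\cdot\dim(P),$$ where $\dim(P)$ is the covering dimension of $P$. -/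

import Mathlib

open Set Filter Topology
open scoped ENNReal

universe u v

noncomputable section

namespace MeanDim

/-! ### Følner sequences and upper Banach density -/

section Amenable

variable {G : Type u} [Group G]

/-- The `K`-boundary `B(F, K)`: the `g` such that `K g` meets both `F` and its complement. -/
def boundary (F K : Finset G) : Set G :=
  {g | (∃ k ∈ K, k * g ∈ F) ∧ ∃ k ∈ K, k * g ∉ F}

/-- `F` is a Følner sequence of `G`: nonempty finite sets with `|B(F n, K)| / |F n| → 0` for every
nonempty finite `K`. (The group is amenable when there is such a sequence.) -/
def IsFolner (F : ℕ → Finset G) : Prop :=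
  (∀ n, (F n).Nonempty) ∧
    ∀ K : Finset G, K.Nonempty →
      Tendsto (fun n => ((boundary (F n) K).ncard : ℝ) / ((F n).card : ℝ)) atTop (𝓝 0)

/-- The upper (Banach) density `δ(J)`: the supremum over all Følner sequences of
`limsup |J ∩ F n| / |F n|`. -/
def upperDensity (J : Set G) : ℝ≥0∞ :=
  ⨆ (F : ℕ → Finset G) (_ : IsFolner F),
    limsup (fun n => ((J ∩ (F n : Set G)).ncard : ℝ≥0∞) / ((F n).card : ℝ≥0∞)) atTop

end Amenable

/-! ### Topological (covering) dimension -/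

section CoverDim

variable (X : Type v) [TopologicalSpace X]

/-- Finite open covers. -/
def IsFiniteOpenCover {X : Type v} [TopologicalSpace X] (α : Set (Set X)) : Prop :=
  α.Finite ∧ (∀ U ∈ α, IsOpen U) ∧ ⋃₀ α = univ

/-- `β` is finer than `α`. -/
def Finer {X : Type v} (β α : Set (Set X)) : Prop :=
  ∀ V ∈ β, ∃ U ∈ α, V ⊆ U

/-- `ord α`: the maximal number of members of `α` with a common point, minus one. (The subtraction
is only truncated on the empty space.) -/
def coverOrder {X : Type v} (α : Set (Set X)) : ℕ∞ :=
  (⨆ x : X, {U ∈ α | x ∈ U}.encard) - 1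

/-- `D(α)`: the least order of a finite open cover finer than `α`. -/
def coverD {X : Type v} [TopologicalSpace X] (α : Set (Set X)) : ℕ∞ :=
  ⨅ (β : Set (Set X)) (_ : IsFiniteOpenCover β ∧ Finer β α), coverOrder β

/-- The topological dimension of a nonempty compact space: the supremum of `D(α)` over all finite
open covers `α`. -/
def topDim : ℕ∞ :=
  ⨆ (α : Set (Set X)) (_ : IsFiniteOpenCover α), coverD α

end CoverDim

/-! ### Polyhedra -/

/-- `P` is a (compact) polyhedron: it is homeomorphic to the underlying space of a finite
simplicial complex in some Euclidean space. -/
def IsPolyhedron (P : Type v) [TopologicalSpace P] : Prop :=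
  ∃ (n : ℕ) (K : Geometry.SimplicialComplex ℝ (EuclideanSpace ℝ (Fin n))),
    K.faces.Finite ∧ Nonempty (P ≃ₜ K.space)

/-! ### Mean topological dimension -/

section MeanDimension

variable {X : Type v}

/-- A map `f` is `ε`-injective for the distance `d` when its fibres have `d`-diameter at most
`ε`. -/
def EpsInjective {Q : Type*} (d : X → X → ℝ) (ε : ℝ) (f : X → Q) : Prop :=
  ∀ x y, f x = f y → d x y ≤ ε

/-- `dim_ε(X, d)`: the infimum of `dim Q` over all compact metric spaces `Q` that admit a continuous
`ε`-injective map `X → Q`. (Every compact metric space is homeomorphic to one in `Type`, so nothing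
is lost by taking `Q` there.) -/
def dimEps [TopologicalSpace X] (d : X → X → ℝ) (ε : ℝ) : ℕ∞ :=
  ⨅ (Q : Type) (_ : MetricSpace Q) (_ : CompactSpace Q) (f : X → Q)
    (_ : Continuous f ∧ EpsInjective d ε f), topDim Q

variable {G : Type u} [Group G] [MulAction G X]

/-- `d_F(x, y) = max_{g ∈ F} d(g x, g y)`, for a nonempty finite set `F`. -/
def orbitDist (d : X → X → ℝ) (F : Finset G) (x y : X) : ℝ :=
  ⨆ g : F, d ((g : G) • x) ((g : G) • y)

variable [TopologicalSpace X]

/-- `mdim_ε(X, d, G)` computed along the sequence `F`: the limit of `dim_ε(X, d_{F n}) / |F n|`.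
It is written as a lower limit, which is the limit whenever the limit exists (as it does for a
Følner sequence and a continuous action on a compact metric space). -/
def mdimEps (d : X → X → ℝ) (F : ℕ → Finset G) (ε : ℝ) : ℝ≥0∞ :=
  liminf (fun n => (dimEps (orbitDist d (F n)) ε : ℝ≥0∞) / ((F n).card : ℝ≥0∞)) atTop

/-- `mdim(X, G)`, computed with the metric `d` and along `F`: the limit of `mdim_ε(X, d, G)` as
`ε → 0`. As `mdim_ε` increases when `ε` decreases, it is the supremum over `ε > 0`;
see `tendsto_mdimEps`. -/
def mdim (d : X → X → ℝ) (F : ℕ → Finset G) : ℝ≥0∞ :=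
  ⨆ (ε : ℝ) (_ : 0 < ε), mdimEps d F ε

theorem dimEps_antitone (d : X → X → ℝ) : Antitone (dimEps d) := by
  intro a b hab
  unfold dimEps
  refine iInf_mono fun Q => iInf_mono fun _ => iInf_mono fun _ => iInf_mono fun f => ?_
  exact le_iInf fun h => iInf_le_of_le ⟨h.1, fun x y e => (h.2 x y e).trans hab⟩ le_rfl

theorem mdimEps_antitone (d : X → X → ℝ) (F : ℕ → Finset G) : Antitone (mdimEps d F) := by
  intro a b hab
  refine liminf_le_liminf (Eventually.of_forall fun n => ?_)
  have h := dimEps_antitone (orbitDist d (F n)) hab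
  exact ENNReal.div_le_div_right (by exact_mod_cast h) _

/-- `mdim` is the limit of `mdim_ε` as `ε → 0`. -/
theorem tendsto_mdimEps (d : X → X → ℝ) (F : ℕ → Finset G) :
    Tendsto (mdimEps d F) (𝓝[>] 0) (𝓝 (mdim d F)) := by
  have h := (mdimEps_antitone d F).tendsto_nhdsGT (0 : ℝ)
  rwa [sSup_image] at h

end MeanDimension

/-! ### Subshifts -/

section Shift

variable (G : Type u) [Group G] (P : Type v) [TopologicalSpace P]

/-- The shift on `P ^ G`: `(h x)_g = x_{g h}`. -/
def shift {G : Type u} [Group G] {P : Type v} (h : G) (x : G → P) : G → P :=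
  fun g => x (g * h)

/-- A subshift of `P ^ G`: a closed shift-invariant subset (for the product topology). -/
structure Subshift where
  /-- the underlying set -/
  carrier : Set (G → P)
  isClosed : IsClosed carrier
  shift_mem : ∀ (h : G), ∀ x ∈ carrier, shift h x ∈ carrier

/-- The group acts on a subshift by the shift. -/
instance Subshift.mulAction {G : Type u} [Group G] {P : Type v} [TopologicalSpace P]
    (X : Subshift G P) : MulAction G X.carrier where
  smul h x := ⟨shift h x.1, X.shift_mem h x.1 x.2⟩
  one_smul x := Subtype.ext (funext fun g => congrArg x.1 (mul_one g))
  mul_smul h k x := Subtype.ext (funext fun g => congrArg x.1 (mul_assoc g h k).symm)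

end Shift

end MeanDim

end

/-! The action on `P^G` moves coordinates, so a large cube inside `X` can be seen along a Følner set
`F n`. A polyhedron `P` contains a topological cube of some dimension `k ≥ dim P`, whose opposite
faces are more than some `η > 0` apart. By double counting, some right translate `F n * g` meets `J`
in at least `δ(J) |F n|` points. Put `f_h ∘ ψ`, with independent parameters, at those positions `h`,
and a fixed point of `∏ W_g` elsewhere: this maps a cube of dimension `k |F n * g ∩ J|` into `X`.
After translation by `g`, the condition `d(x, y) ≤ c d(f_h x, f_h y)` keeps opposite faces apart at
a fixed scale `ε`, independent of `n`, for the metric `ρ_{F n}`.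

An `ε`-injective map to `Q` therefore never identifies points of opposite faces, and Lebesgue's
covering theorem gives `dim Q ≥ k |F n * g ∩ J| ≥ dim P · δ(J) |F n|`. Division by `|F n|` gives the
claim.

Two topological facts carry this. Lebesgue's theorem (`exists_mem_succ_members`) comes from a degree
computation on Kuhn's triangulation: the oriented volumes of the image simplices of a labelling
adapted to the faces add up to that of the cube, so some image simplex is nondegenerate. The bound
`dim P ≤ k` (`topDim_le_of_card_le`) comes from a grid in general position: every point of `P` has
at most `k` coordinates on it, which yields a fine cover of order at most `k`. -/

namespace MeanDim

/-! ### Simplicial cochains and cup products -/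

section Cochains

variable {V : Type*}

/-- Delete the entry with index `k` of a sequence. -/
def deleteAt (k : ℕ) (w : ℕ → V) (j : ℕ) : V := if j < k then w j else w (j + 1)

theorem deleteAt_zero (w : ℕ → V) : deleteAt 0 w = fun j => w (j + 1) := by
  funext j; simp [deleteAt]

theorem deleteAt_succ_zero (k : ℕ) (w : ℕ → V) : deleteAt (k + 1) w 0 = w 0 := by
  simp [deleteAt]

theorem deleteAt_succ_tail (k : ℕ) (w : ℕ → V) :
    (fun j => deleteAt (k + 1) w (j + 1)) = deleteAt k fun j => w (j + 1) := by
  funext j; simp [deleteAt]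

/-- The coboundary of an `n - 1`-cochain, evaluated at the ordered simplex `w 0, …, w n`. -/
def coboundary (n : ℕ) (c : (ℕ → V) → ℤ) (w : ℕ → V) : ℤ :=
  ∑ k ∈ Finset.range (n + 1), (-1) ^ k * c (deleteAt k w)

/-- The cup product of the differential of `g` with a cochain. -/
def cupDiff (g : V → ℤ) (c : (ℕ → V) → ℤ) (w : ℕ → V) : ℤ :=
  (g (w 1) - g (w 0)) * c fun j => w (j + 1)

/-- The cup product of a function with a cochain. -/
def cupFun (h : V → ℤ) (c : (ℕ → V) → ℤ) (w : ℕ → V) : ℤ := h (w 0) * c w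

theorem coboundary_succ (n : ℕ) (c : (ℕ → V) → ℤ) (w : ℕ → V) :
    coboundary (n + 1) c w = c (fun j => w (j + 1)) -
      ∑ k ∈ Finset.range (n + 1), (-1) ^ k * c (deleteAt (k + 1) w) := by
  rw [coboundary, Finset.sum_range_succ', ← deleteAt_zero]
  simp only [pow_succ, pow_zero, one_mul, mul_neg, mul_one, neg_mul, Finset.sum_neg_distrib]
  ring

/-- Leibniz rule for a closed factor of degree one: the faces that omit `w 0` and `w 1` combine
through `(g₂ - g₁) - (g₂ - g₀) = -(g₁ - g₀)`, and the sign is the cost of moving the coboundary past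
`dg`. -/
theorem coboundary_cupDiff (n : ℕ) (g : V → ℤ) (c : (ℕ → V) → ℤ) (w : ℕ → V) :
    coboundary (n + 1) (cupDiff g c) w = -cupDiff g (coboundary n c) w := by
  rw [coboundary_succ]
  simp only [cupDiff, deleteAt_succ_zero, deleteAt_succ_tail]
  rw [coboundary, Finset.sum_range_succ', Finset.sum_range_succ' _ n]
  have h (k : ℕ) : deleteAt (k + 1 + 1) w 1 = w 1 := by simp [deleteAt]
  have h0 : deleteAt (0 + 1) w 1 = w 2 := by simp [deleteAt]
  simp only [h, h0, deleteAt_zero]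
  rw [mul_add, Finset.mul_sum]
  have : ∀ k ∈ Finset.range n, (-1) ^ (k + 1) *
      ((g (w 1) - g (w 0)) * c (deleteAt (k + 1) fun j => w (j + 1))) =
      (g (w 1) - g (w 0)) * ((-1) ^ (k + 1) * c (deleteAt (k + 1) fun j => w (j + 1))) :=
    fun k _ => by ring
  rw [Finset.sum_congr rfl this]
  simp only [Nat.reduceAdd, zero_add]
  ring

theorem coboundary_cupFun (n : ℕ) (h : V → ℤ) (c : (ℕ → V) → ℤ) (w : ℕ → V) :
    coboundary (n + 1) (cupFun h c) w = cupDiff h c w + h (w 0) * coboundary (n + 1) c w := by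
  rw [coboundary_succ, coboundary_succ]
  simp only [cupFun, cupDiff, deleteAt_succ_zero]
  have : ∀ k ∈ Finset.range (n + 1), (-1) ^ k * (h (w 0) * c (deleteAt (k + 1) w)) =
      h (w 0) * ((-1) ^ k * c (deleteAt (k + 1) w)) := fun k _ => by ring
  rw [Finset.sum_congr rfl this, ← Finset.mul_sum]
  simp only [zero_add]
  ring

/-- The cup product of the differentials of a list of functions. -/
def cupList : List (V → ℤ) → (ℕ → V) → ℤ
  | [] => fun _ => 1
  | g :: l => cupDiff g (cupList l)

theorem coboundary_cupList (l : List (V → ℤ)) (w : ℕ → V) :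
    coboundary (l.length + 1) (cupList l) w = 0 := by
  induction l generalizing w with
  | nil => simp [coboundary, cupList, Finset.sum_range_succ]
  | cons g l ih =>
    rw [List.length_cons, cupList, coboundary_cupDiff, cupDiff, ih]
    simp

/-- The cup product of the differentials of `l₁`, the function `h`, and the differentials of
`l₂`. -/
def cupInsert (h : V → ℤ) (l₂ : List (V → ℤ)) : List (V → ℤ) → (ℕ → V) → ℤ
  | [] => cupFun h (cupList l₂)
  | g :: l => cupDiff g (cupInsert h l₂ l)

/-- Replacing the factor `dh` by `h` gives a primitive of the cup product, since all other factors
are closed; the sign comes from passing the factors of `l₁`. -/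
theorem coboundary_cupInsert (h : V → ℤ) (l₂ l₁ : List (V → ℤ)) (w : ℕ → V) :
    coboundary (l₁.length + l₂.length + 1) (cupInsert h l₂ l₁) w =
      (-1) ^ l₁.length * cupList (l₁ ++ h :: l₂) w := by
  induction l₁ generalizing w with
  | nil => simp [cupInsert, cupList, coboundary_cupFun, coboundary_cupList]
  | cons g l ih =>
    have e : (g :: l).length + l₂.length + 1 = (l.length + l₂.length + 1) + 1 := by
      simp; ring
    rw [e, cupInsert, coboundary_cupDiff, cupDiff, ih, List.cons_append, cupList, cupDiff,
      List.length_cons]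
    ring

/-- Simplices are coded by infinite sequences, so it must be recorded that only the entries up to
the degree matter. -/
theorem cupList_congr (l : List (V → ℤ)) {w w' : ℕ → V} (hw : ∀ j ≤ l.length, w j = w' j) :
    cupList l w = cupList l w' := by
  induction l generalizing w w' with
  | nil => rfl
  | cons g l ih =>
    simp only [List.length_cons] at hw
    rw [cupList, cupDiff, cupDiff, hw 0 (by omega), hw 1 (by omega),
      ih (w := fun j => w (j + 1)) (w' := fun j => w' (j + 1)) fun j hj => hw _ (by omega)]

theorem cupInsert_congr (h : V → ℤ) (l₂ l₁ : List (V → ℤ)) {w w' : ℕ → V}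
    (hw : ∀ j ≤ l₁.length + l₂.length, w j = w' j) :
    cupInsert h l₂ l₁ w = cupInsert h l₂ l₁ w' := by
  induction l₁ generalizing w w' with
  | nil =>
    rw [cupInsert, cupFun, cupFun, hw 0 (by omega),
      cupList_congr l₂ (w := w) (w' := w') fun j hj => hw _ (by simpa using hj)]
  | cons g l ih =>
    simp only [List.length_cons] at hw
    rw [cupInsert, cupDiff, cupDiff, hw 0 (by omega), hw 1 (by omega),
      ih (w := fun j => w (j + 1)) (w' := fun j => w' (j + 1)) fun j hj => hw _ (by omega)]

theorem cupList_eq_zero {l : List (V → ℤ)} {g : V → ℤ} (hg : g ∈ l) {a : ℤ} {w : ℕ → V}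
    (hw : ∀ j ≤ l.length, g (w j) = a) : cupList l w = 0 := by
  induction l generalizing w with
  | nil => simp at hg
  | cons f l ih =>
    simp only [List.length_cons] at hw
    rcases List.mem_cons.1 hg with rfl | h
    · rw [cupList, cupDiff, hw 0 (by omega), hw 1 (by omega)]; simp
    · rw [cupList, cupDiff, ih h fun j hj => hw _ (by omega), mul_zero]

theorem cupInsert_eq_zero {h : V → ℤ} {l₂ l₁ : List (V → ℤ)} {g : V → ℤ}
    (hg : g ∈ l₁ ∨ g ∈ l₂) {a : ℤ} {w : ℕ → V}
    (hw : ∀ j ≤ l₁.length + l₂.length, g (w j) = a) : cupInsert h l₂ l₁ w = 0 := by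
  induction l₁ generalizing w with
  | nil =>
    have h2 : g ∈ l₂ := by simpa using hg
    rw [cupInsert, cupFun, cupList_eq_zero h2 fun j hj => hw j (by simpa using hj), mul_zero]
  | cons f l ih =>
    simp only [List.length_cons] at hw
    by_cases hgf : g = f
    · subst hgf
      rw [cupInsert, cupDiff, hw 0 (by omega), hw 1 (by omega)]; simp
    · rw [cupInsert, cupDiff, ih (by simpa [hgf] using hg) fun j hj => hw _ (by omega), mul_zero]

theorem cupInsert_eq_zero_of_fun {h : V → ℤ} {l₂ l₁ : List (V → ℤ)} {w : ℕ → V}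
    (hw : ∀ j ≤ l₁.length + l₂.length, h (w j) = 0) : cupInsert h l₂ l₁ w = 0 := by
  induction l₁ generalizing w with
  | nil => rw [cupInsert, cupFun, hw 0 (by omega), zero_mul]
  | cons f l ih =>
    simp only [List.length_cons] at hw
    rw [cupInsert, cupDiff, ih fun j hj => hw _ (by omega), mul_zero]

theorem cupList_sub (l₁ l₂ : List (V → ℤ)) (a b : V → ℤ) (w : ℕ → V) :
    cupList (l₁ ++ (a - b) :: l₂) w = cupList (l₁ ++ a :: l₂) w - cupList (l₁ ++ b :: l₂) w := by
  induction l₁ generalizing w with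
  | nil => simp [cupList, cupDiff]; ring
  | cons g l ih => simp only [List.cons_append, cupList, cupDiff, ih]; ring

theorem cupList_ofFn {m : ℕ} (g : Fin m → V → ℤ) (w : ℕ → V) :
    cupList (List.ofFn g) w = ∏ j : Fin m, (g j (w (j + 1)) - g j (w j)) := by
  induction m generalizing w with
  | zero => simp [cupList]
  | succ m ih =>
    rw [List.ofFn_succ, cupList, cupDiff, ih, Fin.prod_univ_succ]
    simp

end Cochains

/-! ### Kuhn's triangulation and the degree of a labelling -/

section Kuhn

variable {m : ℕ}

/-- The vertices of the simplex with lowest vertex `v` and edge directions `e (π 0), e (π 1), …`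
in Kuhn's triangulation of the cubical grid. -/
def kuhnChain (v : Fin m → ℕ) (π : Equiv.Perm (Fin m)) (j : ℕ) (i : Fin m) : ℕ :=
  v i + if (π.symm i : ℕ) < j then 1 else 0

/-- The lower vertices of the cubes of the grid with side length `N`. -/
def gridBox (m N : ℕ) : Finset (Fin m → ℕ) := Fintype.piFinset fun _ => Finset.range N

/-- The sum of the values of a cochain on the oriented simplices of Kuhn's triangulation. -/
def kuhnSum (m N : ℕ) (c : (ℕ → Fin m → ℕ) → ℤ) : ℤ :=
  ∑ π : Equiv.Perm (Fin m), ∑ v ∈ gridBox m N, (Equiv.Perm.sign π : ℤ) * c (kuhnChain v π)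

theorem mem_gridBox {N : ℕ} {v : Fin m → ℕ} : v ∈ gridBox m N ↔ ∀ i, v i < N := by
  simp [gridBox]

theorem sum_gridBox_shift (N : ℕ) (l : Fin m) (Φ : (Fin m → ℕ) → ℤ)
    (h0 : ∀ v, v l = 0 → Φ v = 0) (hN : ∀ v, v l = N → Φ v = 0) :
    ∑ v ∈ gridBox m N, Φ (v + Pi.single l 1) = ∑ v ∈ gridBox m N, Φ v := by
  refine Finset.sum_bij_ne_zero (fun v _ _ => v + Pi.single l 1) ?_ ?_ ?_ ?_
  · intro v hv hne
    rw [mem_gridBox] at hv ⊢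
    intro i
    by_cases hi : i = l
    · subst hi
      have h1 : v i + 1 ≠ N := fun h => hne (hN _ (by simpa using h))
      have := hv i
      simp; omega
    · simpa [hi] using hv i
  · intro v _ _ v' _ _ h
    exact add_right_cancel h
  · intro v hv hne
    rw [mem_gridBox] at hv
    have h1 : v l ≠ 0 := fun h => hne (h0 _ h)
    have e : (v - Pi.single l 1) + Pi.single l 1 = v := by
      funext i
      by_cases hi : i = l
      · subst hi; simp; omega
      · simp [hi]
    refine ⟨v - Pi.single l 1, ?_, by rwa [e], e⟩
    rw [mem_gridBox]
    intro i
    have := hv i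
    simp only [Pi.sub_apply]
    omega
  · intros; rfl

theorem deleteAt_kuhnChain_swap (v : Fin m → ℕ) (π : Equiv.Perm (Fin m)) (k : ℕ)
    (h1 : k + 1 < m) :
    deleteAt (k + 1) (kuhnChain v (π * Equiv.swap ⟨k, by omega⟩ ⟨k + 1, h1⟩)) =
      deleteAt (k + 1) (kuhnChain v π) := by
  have key : ∀ j, j ≠ k + 1 →
      kuhnChain v (π * Equiv.swap ⟨k, by omega⟩ ⟨k + 1, h1⟩) j = kuhnChain v π j := by
    intro j hj
    funext i
    have e : (π * Equiv.swap (⟨k, by omega⟩ : Fin m) ⟨k + 1, h1⟩).symm i =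
        Equiv.swap (⟨k, by omega⟩ : Fin m) ⟨k + 1, h1⟩ (π.symm i) := by
      rw [Equiv.symm_apply_eq]; simp
    simp only [kuhnChain, e]
    congr 1
    generalize π.symm i = t
    rw [Equiv.swap_apply_def]
    have : ((if t = ⟨k, by omega⟩ then (⟨k + 1, h1⟩ : Fin m) else if t = ⟨k + 1, h1⟩ then
      ⟨k, by omega⟩ else t : Fin m) : ℕ) < j ↔ (t : ℕ) < j := by
      split_ifs with a b
      · subst a; simp; omega
      · subst b; simp; omega
      · rfl
    simp only [this]
  funext j
  simp only [deleteAt]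
  split_ifs with h
  · exact key j (by omega)
  · exact key (j + 1) (by omega)

/-- The facet opposite an intermediate vertex is shared by the simplices of `π` and `π * swap`,
which have opposite signs, so the sum equals its own negative. -/
theorem kuhnSum_deleteAt_middle (N : ℕ) (c : (ℕ → Fin m → ℕ) → ℤ) (k : ℕ) (h1 : k + 1 < m) :
    kuhnSum m N (fun w => c (deleteAt (k + 1) w)) = 0 := by
  set s : Equiv.Perm (Fin m) := Equiv.swap ⟨k, by omega⟩ ⟨k + 1, h1⟩ with hs
  have : kuhnSum m N (fun w => c (deleteAt (k + 1) w)) =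
      -kuhnSum m N (fun w => c (deleteAt (k + 1) w)) := by
    conv_lhs => rw [kuhnSum, ← Equiv.sum_comp (Equiv.mulRight s)]
    rw [kuhnSum, ← Finset.sum_neg_distrib]
    refine Finset.sum_congr rfl fun π _ => ?_
    rw [← Finset.sum_neg_distrib]
    refine Finset.sum_congr rfl fun v _ => ?_
    simp only [Equiv.coe_mulRight, Equiv.Perm.sign_mul, hs, deleteAt_kuhnChain_swap]
    simp
  omega

/-- The facet opposite the lowest vertex is the facet opposite the highest vertex of a simplex in
the adjacent cube in direction `π 0`, where that direction comes last. -/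
theorem kuhnChain_rotate {n : ℕ} (v : Fin (n + 1) → ℕ) (π : Equiv.Perm (Fin (n + 1))) (j : ℕ)
    (hj : j ≤ n) :
    kuhnChain (v + Pi.single (π 0) 1) (π * finRotate (n + 1)) j = kuhnChain v π (j + 1) := by
  funext i
  obtain ⟨t, rfl⟩ := (π * finRotate (n + 1)).surjective i
  simp only [kuhnChain, Equiv.symm_apply_apply]
  simp only [Equiv.Perm.mul_apply, Equiv.symm_apply_apply, Pi.add_apply, add_assoc]
  congr 1
  by_cases ht : t = Fin.last n
  · subst ht
    simp only [finRotate_last, Pi.single_eq_same]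
    simp; omega
  · have h1 : (finRotate (n + 1) t : ℕ) = t + 1 := by
      exact coe_finRotate_of_ne_last ht
    have h2 : finRotate (n + 1) t ≠ 0 := fun h => by simp [h] at h1
    rw [Pi.single_eq_of_ne (fun h => h2 (π.injective h)), h1]
    simp

/-- Stokes' theorem for Kuhn's triangulation, in the case of a cochain that vanishes on the
boundary of the cube. -/
theorem kuhnSum_coboundary {n : ℕ} (N : ℕ) (c : (ℕ → Fin (n + 1) → ℕ) → ℤ)
    (hc : ∀ w w', (∀ j ≤ n, w j = w' j) → c w = c w')
    (h0 : ∀ w l, (∀ j ≤ n, w j l = 0) → c w = 0)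
    (hN : ∀ w l, (∀ j ≤ n, w j l = N) → c w = 0) :
    kuhnSum (n + 1) N (coboundary (n + 1) c) = 0 := by
  have e : kuhnSum (n + 1) N (coboundary (n + 1) c) =
      ∑ k ∈ Finset.range (n + 1 + 1),
        (-1) ^ k * kuhnSum (n + 1) N (fun w => c (deleteAt k w)) := by
    simp only [kuhnSum, coboundary, Finset.mul_sum]
    rw [Finset.sum_comm' (t' := Finset.univ) (s' := fun _ => Finset.range (n + 1 + 1)) (by simp)]
    refine Finset.sum_congr rfl fun π _ => ?_
    rw [Finset.sum_comm]
    refine Finset.sum_congr rfl fun v _ => ?_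
    refine Finset.sum_congr rfl fun k _ => ?_
    ring
  rw [e, Finset.sum_range_succ', Finset.sum_range_succ]
  rw [Finset.sum_eq_zero fun k hk => by
    rw [kuhnSum_deleteAt_middle N c k (by simpa using hk), mul_zero]]
  -- The rotation has sign `(-1) ^ n` while the last facet carries `(-1) ^ (n + 1)`, so the first
  -- and last facets cancel.
  have hfirst : kuhnSum (n + 1) N (fun w => c (deleteAt 0 w)) =
      (-1) ^ n * kuhnSum (n + 1) N c := by
    conv_rhs => rw [kuhnSum, ← Equiv.sum_comp (Equiv.mulRight (finRotate (n + 1)))]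
    rw [kuhnSum, Finset.mul_sum]
    refine Finset.sum_congr rfl fun π _ => ?_
    simp only [Equiv.coe_mulRight, Equiv.Perm.sign_mul, sign_finRotate]
    rw [← sum_gridBox_shift N (π 0) (fun v => (((Equiv.Perm.sign π * (-1) ^ (n + 1 - 1) : ℤˣ) : ℤ) *
      c (kuhnChain v (π * finRotate (n + 1))))), Finset.mul_sum]
    · refine Finset.sum_congr rfl fun v _ => ?_
      rw [hc (kuhnChain (v + Pi.single (π 0) 1) (π * finRotate (n + 1)))
        (deleteAt 0 (kuhnChain v π))]
      · have : ((-1 : ℤ) ^ n) * (-1) ^ n = 1 := by rw [← mul_pow]; simp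
        push_cast
        linear_combination (- (Equiv.Perm.sign π : ℤ) * c (deleteAt 0 (kuhnChain v π))) * this
      · intro j hj
        rw [kuhnChain_rotate v π j hj, deleteAt_zero]
    -- Direction `π 0` comes last in the rotated order, so coordinate `π 0` is constant along the
    -- facet: when it is `0` or `N` the facet lies on the boundary, where `c` vanishes.
    · intro v hv
      rw [h0 _ (π 0), mul_zero]
      intro j hj
      have : (π * finRotate (n + 1)).symm (π 0) = Fin.last n := by
        rw [Equiv.symm_apply_eq]; simp
      simp only [kuhnChain, this, hv]
      simp; omega
    · intro v hv
      rw [hN _ (π 0), mul_zero]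
      intro j hj
      have : (π * finRotate (n + 1)).symm (π 0) = Fin.last n := by
        rw [Equiv.symm_apply_eq]; simp
      simp only [kuhnChain, this, hv]
      simp; omega
  have hlast : kuhnSum (n + 1) N (fun w => c (deleteAt (n + 1) w)) = kuhnSum (n + 1) N c := by
    rw [kuhnSum, kuhnSum]
    refine Finset.sum_congr rfl fun π _ => Finset.sum_congr rfl fun v _ => ?_
    rw [hc (deleteAt (n + 1) (kuhnChain v π)) (kuhnChain v π)]
    intro j hj
    simp [deleteAt, Nat.lt_succ_of_le hj]
  rw [hfirst, hlast]
  ring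

/-- `g i` takes the value `0` on the face `x i = 0` and the value `N` on the face `x i = N`. -/
def IsFaceAdapted (N : ℕ) (g : Fin m → (Fin m → ℕ) → ℤ) : Prop :=
  ∀ i v, (v i = 0 → g i v = 0) ∧ (v i = N → g i v = N)

/-- Stokes applied to the primitive `cupInsert h l₂ l₁`: it vanishes on the faces in direction `i`
because `h` does, and on those in direction `l ≠ i` because a function of the list is constant
there. -/
theorem kuhnSum_cupList_insert {N : ℕ} {h : (Fin m → ℕ) → ℤ} {l₁ l₂ : List ((Fin m → ℕ) → ℤ)}
    (hlen : l₁.length + l₂.length + 1 = m) {i : Fin m}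
    (hi : ∀ v, v i = 0 ∨ v i = N → h v = 0)
    (hl : ∀ l, l ≠ i → ∃ g ∈ l₁ ++ l₂, ∀ v, (v l = 0 → g v = 0) ∧ (v l = N → g v = N)) :
    kuhnSum m N (cupList (l₁ ++ h :: l₂)) = 0 := by
  obtain ⟨n, rfl⟩ : ∃ n, m = n + 1 := ⟨_, hlen.symm⟩
  have hn : l₁.length + l₂.length = n := by omega
  have main := kuhnSum_coboundary N (cupInsert h l₂ l₁)
    (fun w w' hw => cupInsert_congr h l₂ l₁ (by rwa [hn]))
    (by
      intro w l hw
      by_cases hli : l = i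
      · subst hli
        exact cupInsert_eq_zero_of_fun fun j hj => hi _ (Or.inl (hw j (hn ▸ hj)))
      · obtain ⟨g, hg, hg'⟩ := hl l hli
        exact cupInsert_eq_zero (List.mem_append.1 hg) fun j hj => (hg' _).1 (hw j (hn ▸ hj)))
    (by
      intro w l hw
      by_cases hli : l = i
      · subst hli
        exact cupInsert_eq_zero_of_fun fun j hj => hi _ (Or.inr (hw j (hn ▸ hj)))
      · obtain ⟨g, hg, hg'⟩ := hl l hli
        exact cupInsert_eq_zero (List.mem_append.1 hg) fun j hj => (hg' _).2 (hw j (hn ▸ hj)))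
  have e : coboundary (n + 1) (cupInsert h l₂ l₁) =
      fun w => (-1) ^ l₁.length * cupList (l₁ ++ h :: l₂) w := by
    funext w
    rw [← coboundary_cupInsert, hn]
  rw [e] at main
  have e2 : kuhnSum (n + 1) N (fun w => (-1) ^ l₁.length * cupList (l₁ ++ h :: l₂) w) =
      (-1) ^ l₁.length * kuhnSum (n + 1) N (cupList (l₁ ++ h :: l₂)) := by
    simp only [kuhnSum, Finset.mul_sum]
    refine Finset.sum_congr rfl fun π _ => Finset.sum_congr rfl fun v _ => ?_
    ring
  rw [e2] at main
  exact (mul_eq_zero.1 main).resolve_left (pow_ne_zero _ (by norm_num))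

/-- Homotopy invariance: the functions are exchanged one at a time, and `g i - g' i` vanishes on
both faces in direction `i`, so each exchange leaves the sum unchanged. -/
theorem kuhnSum_cupList_congr {N : ℕ} {g g' : Fin m → (Fin m → ℕ) → ℤ} (hg : IsFaceAdapted N g)
    (hg' : IsFaceAdapted N g') (l₁ l₂ : List (Fin m)) (hlen : (l₁ ++ l₂).length = m)
    (hl : ∀ i, i ∈ l₁ ++ l₂) :
    kuhnSum m N (cupList (l₁.map g' ++ l₂.map g)) = kuhnSum m N (cupList ((l₁ ++ l₂).map g')) := by
  induction l₂ generalizing l₁ with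
  | nil => simp
  | cons i l₂ ih =>
    have := ih (l₁ ++ [i]) (by simpa using hlen) (by simpa using hl)
    simp only [List.append_assoc, List.cons_append, List.nil_append, List.map_append, List.map_cons,
      List.map_nil] at this ⊢
    rw [← this]
    have key : kuhnSum m N (cupList (l₁.map g' ++ (g i - g' i) :: l₂.map g)) = 0 := by
      refine kuhnSum_cupList_insert (i := i) ?_ ?_ ?_
      · simp at hlen ⊢; omega
      · rintro v (h | h)
        · simp [(hg i v).1 h, (hg' i v).1 h]
        · simp [(hg i v).2 h, (hg' i v).2 h]
      · intro l hli
        have := hl l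
        simp only [List.mem_append, List.mem_cons, hli, false_or] at this
        rcases this with h | h
        · exact ⟨g' l, List.mem_append.2 (Or.inl (List.mem_map_of_mem h)), hg' l⟩
        · exact ⟨g l, List.mem_append.2 (Or.inr (List.mem_map_of_mem h)), hg l⟩
    have e : kuhnSum m N (cupList (l₁.map g' ++ (g i - g' i) :: l₂.map g)) =
        kuhnSum m N (cupList (l₁.map g' ++ g i :: l₂.map g)) -
        kuhnSum m N (cupList (l₁.map g' ++ g' i :: l₂.map g)) := by
      simp only [kuhnSum, ← Finset.sum_sub_distrib, cupList_sub, mul_sub]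
    linarith

/-- The labelling may be replaced by the coordinate functions; for them the product is `1` on the
simplices with `π = σ` and `0` on all others, and there is one such simplex in each of the `N ^ m`
cubes. -/
theorem kuhnSum_prod {N : ℕ} {g : Fin m → (Fin m → ℕ) → ℤ} (hg : IsFaceAdapted N g)
    (σ : Equiv.Perm (Fin m)) :
    kuhnSum m N (fun w => ∏ j, (g (σ j) (w (j + 1)) - g (σ j) (w j))) =
      Equiv.Perm.sign σ * (N : ℤ) ^ m := by
  have hX : IsFaceAdapted N (fun (i : Fin m) (v : Fin m → ℕ) => (v i : ℤ)) :=
    fun i v => ⟨fun h => by simp [h], fun h => by simp [h]⟩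
  have h := kuhnSum_cupList_congr hg hX [] (List.ofFn σ) (by simp)
    (by intro i; simpa using σ.surjective i)
  simp only [List.map_nil, List.nil_append, List.map_ofFn] at h
  have e1 : (fun w => ∏ j, (g (σ j) (w (j + 1)) - g (σ j) (w j))) =
      cupList (List.ofFn (g ∘ σ)) := by
    funext w; rw [cupList_ofFn]; rfl
  rw [e1, h]
  have e2 : ∀ (v : Fin m → ℕ) (π : Equiv.Perm (Fin m)),
      cupList (List.ofFn ((fun (i : Fin m) (v : Fin m → ℕ) => (v i : ℤ)) ∘ σ)) (kuhnChain v π) =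
        if π = σ then 1 else 0 := by
    intro v π
    rw [cupList_ofFn]
    have : ∀ j : Fin m, ((kuhnChain v π (j + 1) (σ j) : ℤ) - kuhnChain v π j (σ j)) =
        if π j = σ j then 1 else 0 := by
      intro j
      have : π j = σ j ↔ (π.symm (σ j) : ℕ) = j := by
        rw [← Fin.ext_iff, Equiv.symm_apply_eq, eq_comm]
      rw [if_congr this rfl rfl]
      simp only [kuhnChain]
      split_ifs <;> omega
    simp only [Function.comp, this]
    split_ifs with hπ
    · simp [hπ]
    · obtain ⟨j, hj⟩ : ∃ j, π j ≠ σ j := by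
        by_contra! hh; exact hπ (Equiv.ext hh)
      exact Finset.prod_eq_zero (Finset.mem_univ j) (by simp [hj])
  simp only [kuhnSum, e2]
  rw [Finset.sum_eq_single σ]
  · simp [gridBox, mul_comm]
  · intro π _ hπ; simp [hπ]
  · simp

/-- The oriented volumes of the image simplices add up to the one of a cube. -/
theorem kuhnSum_det {N : ℕ} {g : Fin m → (Fin m → ℕ) → ℤ} (hg : IsFaceAdapted N g) :
    kuhnSum m N (fun w => (Matrix.of fun i j : Fin m => g i (w (j + 1)) - g i (w j)).det) =
      (Nat.factorial m : ℤ) * (N : ℤ) ^ m := by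
  have e : kuhnSum m N (fun w => (Matrix.of fun i j : Fin m => g i (w (j + 1)) - g i (w j)).det) =
      ∑ σ : Equiv.Perm (Fin m), (Equiv.Perm.sign σ : ℤ) *
        kuhnSum m N (fun w => ∏ j, (g (σ j) (w (j + 1)) - g (σ j) (w j))) := by
    simp only [kuhnSum, Matrix.det_apply', Finset.mul_sum, Matrix.of_apply]
    rw [Finset.sum_comm (s := (Finset.univ : Finset (Equiv.Perm (Fin m))))
      (t := (Finset.univ : Finset (Equiv.Perm (Fin m))))]
    refine Finset.sum_congr rfl fun π _ => ?_
    rw [Finset.sum_comm]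
    refine Finset.sum_congr rfl fun v _ => Finset.sum_congr rfl fun σ _ => ?_
    simp; ring
  rw [e]
  have : ∀ σ ∈ (Finset.univ : Finset (Equiv.Perm (Fin m))), (Equiv.Perm.sign σ : ℤ) *
        kuhnSum m N (fun w => ∏ j, (g (σ j) (w (j + 1)) - g (σ j) (w j))) = (N : ℤ) ^ m := by
    intro σ _
    rw [kuhnSum_prod hg, ← mul_assoc, ← Units.val_mul, Int.units_mul_self]
    simp
  rw [Finset.sum_congr rfl this]
  simp [Fintype.card_perm]

/-- A combinatorial form of the Lebesgue covering theorem. -/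
theorem exists_kuhnChain_injective {N : ℕ} (hN : 0 < N) {g : Fin m → (Fin m → ℕ) → ℤ}
    (hg : IsFaceAdapted N g) :
    ∃ v ∈ gridBox m N, ∃ π : Equiv.Perm (Fin m),
      Function.Injective fun (j : Fin (m + 1)) (i : Fin m) => g i (kuhnChain v π j) := by
  have h := kuhnSum_det hg
  have hne : ((Nat.factorial m : ℤ) * (N : ℤ) ^ m) ≠ 0 := by positivity
  rw [← h, kuhnSum] at hne
  obtain ⟨π, _, hπ⟩ := Finset.exists_ne_zero_of_sum_ne_zero hne
  obtain ⟨v, hv, hvπ⟩ := Finset.exists_ne_zero_of_sum_ne_zero hπ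
  refine ⟨v, hv, π, ?_⟩
  have hdet := right_ne_zero_of_mul hvπ
  set A : Matrix (Fin m) (Fin m) ℤ :=
    Matrix.of fun i j : Fin m => g i (kuhnChain v π (j + 1)) - g i (kuhnChain v π j) with hA
  have hlt : ∀ a b : Fin (m + 1), a < b →
      (fun i => g i (kuhnChain v π a)) ≠ fun i => g i (kuhnChain v π b) := by
    intro a b hab heq
    apply hdet
    rw [← Matrix.exists_mulVec_eq_zero_iff]
    -- The columns are consecutive differences of labels; those from `a` to `b` telescope to the
    -- difference of the labels at `a` and `b`, which is zero.
    refine ⟨fun j => if (a : ℕ) ≤ j ∧ (j : ℕ) < b then 1 else 0, ?_, ?_⟩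
    · intro h0
      have ha : (a : ℕ) < m := by have := b.2; omega
      have := congrFun h0 ⟨a, ha⟩
      have h2 : (a : ℕ) < b := hab
      simp [h2] at this
    · funext i
      simp only [Matrix.mulVec, dotProduct, hA, Matrix.of_apply, Pi.zero_apply]
      have e := Fin.sum_univ_eq_sum_range (fun j => (g i (kuhnChain v π (j + 1)) -
        g i (kuhnChain v π j)) * if (a : ℕ) ≤ j ∧ j < (b : ℕ) then (1 : ℤ) else 0) m
      rw [e]
      simp only [mul_ite, mul_one, mul_zero]
      rw [← Finset.sum_filter]
      have hs : (Finset.range m).filter (fun j => (a : ℕ) ≤ j ∧ j < (b : ℕ)) =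
          Finset.Ico (a : ℕ) b := by
        ext j; have := b.2; simp; omega
      rw [hs, Finset.sum_Ico_sub (fun j => g i (kuhnChain v π j)) (le_of_lt hab),
        ← congrFun heq i]
      simp
  intro a b hab
  rcases lt_trichotomy a b with h | h | h
  · exact absurd hab (hlt a b h)
  · exact h
  · exact absurd hab.symm (hlt b a h)

end Kuhn

/-! ### Lebesgue's covering theorem and lower bounds for dimension -/

section Lebesgue

open scoped unitInterval

/-- The grid point `v / N` of the unit cube. -/
noncomputable def gridPoint {m : ℕ} (N : ℕ) (v : Fin m → ℕ) : Fin m → I :=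
  fun i => Set.projIcc 0 1 zero_le_one ((v i : ℝ) / N)

theorem dist_gridPoint_le {m N : ℕ} (v : Fin m → ℕ) (π : Equiv.Perm (Fin m)) (j k : ℕ) :
    dist (gridPoint N (kuhnChain v π j)) (gridPoint N (kuhnChain v π k)) ≤ 1 / N := by
  refine (dist_pi_le_iff (by positivity)).2 fun i => ?_
  rw [Subtype.dist_eq, Real.dist_eq]
  refine (abs_projIcc_sub_projIcc zero_le_one).trans ?_
  rw [← sub_div, abs_div, Nat.abs_cast]
  gcongr
  simp only [kuhnChain]
  split_ifs <;> simp

/-- **Lebesgue's covering theorem**: if no member of an open cover of the `m`-cube meets two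
opposite faces, then some point lies in `m + 1` members of the cover. -/
theorem exists_mem_succ_members {m : ℕ} {ι : Type*} {U : ι → Set (Fin m → I)}
    (hU : ∀ a, IsOpen (U a)) (hcov : ∀ x, ∃ a, x ∈ U a)
    (hface : ∀ a, ∀ i, ∀ x ∈ U a, ∀ y ∈ U a, x i = 0 → y i ≠ 1) :
    ∃ (x : Fin m → I) (f : Fin (m + 1) → ι), Function.Injective f ∧ ∀ j, x ∈ U (f j) := by
  obtain ⟨δ, hδ, hball⟩ := lebesgue_number_lemma_of_metric (isCompact_univ (X := Fin m → I))
    hU (fun x _ => mem_iUnion.2 (hcov x))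
  obtain ⟨n, hn⟩ := exists_nat_one_div_lt hδ
  have hN : 1 / ((n + 1 : ℕ) : ℝ) < δ := by simpa using hn
  set N := n + 1
  have hN0 : (N : ℝ) ≠ 0 := by positivity
  choose a ha using fun v : Fin m → ℕ => hball (gridPoint N v) (mem_univ _)
  classical
  -- The label depends on `v` only through the chosen member `a v`, so distinct labels force
  -- distinct members.
  let g : Fin m → (Fin m → ℕ) → ℤ := fun i v => if ∃ x ∈ U (a v), x i = 0 then 0 else N
  have hself : ∀ v, gridPoint N v ∈ U (a v) := fun v => ha v (Metric.mem_ball_self hδ)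
  have hg : IsFaceAdapted N g := by
    refine fun i v => ⟨fun h => if_pos ⟨_, hself v, ?_⟩, fun h => if_neg ?_⟩
    · rintro ⟨x, hx, hxi⟩
      refine hface _ i x hx _ (hself v) hxi ?_
      simp only [gridPoint, h, div_self hN0]
      simp
    · simp [gridPoint, h]
  obtain ⟨v, -, π, hinj⟩ := exists_kuhnChain_injective (Nat.succ_pos n) hg
  refine ⟨gridPoint N (kuhnChain v π 0), fun j => a (kuhnChain v π j), ?_, fun j => ?_⟩
  · intro j k hjk
    refine hinj (funext fun i => ?_)
    simp only [g]
    simp only at hjk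
    rw [hjk]
  · exact ha _ (Metric.mem_ball.2 ((dist_gridPoint_le v π 0 j).trans_lt hN))

/-- The sets that avoid the image of one chosen face from each opposite pair form an open cover of
`Q`. No member of a refinement, pulled back to the cube, meets opposite faces, so Lebesgue's theorem
gives it order at least `m`. -/
theorem natCast_le_topDim {m : ℕ} {Q : Type*} [TopologicalSpace Q] [T2Space Q]
    {φ : (Fin m → I) → Q} (hφ : Continuous φ)
    (hface : ∀ i x y, x i = 0 → y i = 1 → φ x ≠ φ y) : (m : ℕ∞) ≤ topDim Q := by
  classical
  let A : Fin m → I → Set (Fin m → I) := fun i t => {x | x i = t}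
  have hA : ∀ i t, IsClosed (φ '' A i t) := fun i t =>
    ((isClosed_singleton.preimage (continuous_apply i)).isCompact.image hφ).isClosed
  let V : (Fin m → Bool) → Set Q := fun s => ⋂ i, (φ '' A i (if s i then 0 else 1))ᶜ
  have hV : IsFiniteOpenCover (range V) := by
    refine ⟨finite_range V, ?_, ?_⟩
    · rintro _ ⟨s, rfl⟩
      exact isOpen_iInter_of_finite fun i => (hA i _).isOpen_compl
    · refine eq_univ_of_forall fun q => ?_
      refine ⟨_, ⟨fun i => decide (q ∉ φ '' A i 0), rfl⟩, mem_iInter.2 fun i => ?_⟩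
      by_cases h : q ∈ φ '' A i 0
      · obtain ⟨x, hx, rfl⟩ := h
        have h0 : φ x ∈ φ '' A i 0 := ⟨x, hx, rfl⟩
        simp only [h0, not_true_eq_false, decide_false]
        rintro ⟨y, hy, hxy⟩
        exact hface i x y hx (by simpa [A] using hy) hxy.symm
      · simp [h]
  refine le_trans (le_iInf₂ fun β hβ => ?_) (le_iSup₂_of_le (range V) hV le_rfl)
  obtain ⟨⟨-, hopen, hcov⟩, hfine⟩ := hβ
  obtain ⟨x, f, hf, hxf⟩ := exists_mem_succ_members (ι := β) (U := fun W => φ ⁻¹' W.1)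
    (fun W => (hopen _ W.2).preimage hφ)
    (fun x => by
      have : φ x ∈ ⋃₀ β := hcov ▸ mem_univ _
      obtain ⟨W, hW, hx⟩ := this
      exact ⟨⟨W, hW⟩, hx⟩)
    (by
      rintro ⟨W, hW⟩ i x hx y hy hx0 hy1
      obtain ⟨_, ⟨s, rfl⟩, hs⟩ := hfine W hW
      have h1 := mem_iInter.1 (hs hx) i
      have h2 := mem_iInter.1 (hs hy) i
      by_cases hsi : s i
      · exact h1 ⟨x, by simpa [A, hsi] using hx0, rfl⟩
      · exact h2 ⟨y, by simpa [A, hsi] using hy1, rfl⟩)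
  have hcard : ((m + 1 : ℕ) : ℕ∞) ≤ {W ∈ β | φ x ∈ W}.encard := by
    have hinj : Function.Injective fun j => (f j).1 := Subtype.val_injective.comp hf
    calc ((m + 1 : ℕ) : ℕ∞) = (range fun j => (f j).1).encard := by
          rw [← image_univ, hinj.encard_image]; simp
      _ ≤ _ := encard_le_encard (by rintro _ ⟨j, rfl⟩; exact ⟨(f j).2, hxf j⟩)
  calc (m : ℕ∞) = ((m + 1 : ℕ) : ℕ∞) - 1 := by norm_cast
    _ ≤ coverOrder β := tsub_le_tsub_right
      (hcard.trans (le_iSup (fun q : Q => {W ∈ β | q ∈ W}.encard) (φ x))) 1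

theorem natCast_card_le_topDim {κ : Type*} [Fintype κ] {Q : Type*} [TopologicalSpace Q] [T2Space Q]
    {φ : (κ → I) → Q} (hφ : Continuous φ)
    (hface : ∀ i x y, x i = 0 → y i = 1 → φ x ≠ φ y) : (Fintype.card κ : ℕ∞) ≤ topDim Q := by
  let e := Fintype.equivFin κ
  refine natCast_le_topDim (φ := fun x => φ fun i => x (e i)) (by fun_prop) ?_
  intro i x y hx hy
  exact hface (e.symm i) _ _ (by simpa using hx) (by simpa using hy)

end Lebesgue

/-! ### Upper density and finite sets -/

section Density

variable {G : Type*} [Group G]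

theorem finite_boundary (F K : Finset G) : (boundary F K).Finite := by
  classical
  refine (Finset.finite_toSet (K.biUnion fun k => F.image fun x => k⁻¹ * x)).subset ?_
  rintro g ⟨⟨k, hk, hkg⟩, -⟩
  simp only [Finset.coe_biUnion, Finset.coe_image, mem_iUnion]
  exact ⟨k, hk, k * g, hkg, by simp⟩

open Classical in
/-- The translate of `J` that meets a finite set most often does so at least with the frequency of
`J` in any finite set, up to a boundary term. -/
theorem card_mul_le_of_forall_translate (J : Set G) (K F : Finset G) (M : ℕ)
    (hM : ∀ g, (K.filter fun k => k * g ∈ J).card ≤ M) :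
    K.card * (F.filter (· ∈ J)).card ≤
      M * F.card + K.card * (boundary F (insert 1 (K.image fun k => k⁻¹))).ncard := by
  set b := (boundary F (insert 1 (K.image fun k => k⁻¹))).ncard with hb
  have h1 : ∀ k ∈ K, (F.filter (· ∈ J)).card ≤ (F.filter fun g => k * g ∈ J).card + b := by
    intro k hk
    -- Points of `S` are moved by `k⁻¹` to points `g ∈ F` with `k * g ∈ J`; points of `T` lie in `F`
    -- but leave it under `k⁻¹`, so they are boundary points.
    set S := (F.filter (· ∈ J)).filter fun x => k⁻¹ * x ∈ F
    set T := (F.filter (· ∈ J)).filter fun x => ¬ k⁻¹ * x ∈ F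
    have hS : S.card ≤ (F.filter fun g => k * g ∈ J).card := by
      refine Finset.card_le_card_of_injOn (fun x => k⁻¹ * x) ?_ ?_
      · intro x hx
        simp only [S, Finset.coe_filter, Finset.mem_filter, mem_ofPred_eq] at hx ⊢
        exact ⟨hx.2, by simpa using hx.1.2⟩
      · intro x _ y _ h
        simpa using h
    have hT : T.card ≤ b := by
      rw [hb, ← Set.ncard_coe_finset]
      refine Set.ncard_le_ncard ?_ (finite_boundary _ _)
      intro x hx
      simp only [T, Finset.coe_filter, Finset.mem_filter, mem_ofPred_eq] at hx
      refine ⟨⟨1, by simp, by simpa using hx.1.1⟩, ⟨k⁻¹, ?_, hx.2⟩⟩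
      exact Finset.mem_insert_of_mem (Finset.mem_image_of_mem _ hk)
    have : S.card + T.card = (F.filter (· ∈ J)).card := by
      rw [← Finset.card_filter_add_card_filter_not (s := F.filter (· ∈ J))
        (fun x => k⁻¹ * x ∈ F)]
    omega
  have h2 : ∑ k ∈ K, (F.filter fun g => k * g ∈ J).card =
      ∑ g ∈ F, (K.filter fun k => k * g ∈ J).card := by
    simp only [Finset.card_filter]
    exact Finset.sum_comm
  calc K.card * (F.filter (· ∈ J)).card = ∑ k ∈ K, (F.filter (· ∈ J)).card := by simp
    _ ≤ ∑ k ∈ K, ((F.filter fun g => k * g ∈ J).card + b) := Finset.sum_le_sum h1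
    _ = ∑ g ∈ F, (K.filter fun k => k * g ∈ J).card + K.card * b := by
      rw [Finset.sum_add_distrib, h2]; simp
    _ ≤ ∑ g ∈ F, M + K.card * b := by gcongr with g _; exact hM g
    _ = _ := by simp [mul_comm]

-- A translate with the maximal count `M` works: along every Følner sequence the double count bounds
-- the frequency of `J` by `M / |K|` plus a boundary term that tends to zero.
open Classical in
theorem exists_upperDensity_mul_card_le (J : Set G) {K : Finset G} (hK : K.Nonempty) :
    ∃ g : G, upperDensity J * (K.card : ℝ≥0∞) ≤ ((K.filter fun k => k * g ∈ J).card : ℝ≥0∞) := by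
  have hbdd : BddAbove (range fun g : G => (K.filter fun k => k * g ∈ J).card) :=
    ⟨K.card, by rintro _ ⟨g, rfl⟩; exact Finset.card_filter_le _ _⟩
  obtain ⟨g, hg⟩ := Nat.sSup_mem (range_nonempty _) hbdd
  refine ⟨g, ?_⟩
  set M := (K.filter fun k => k * g ∈ J).card with hMdef
  have hM : ∀ g', (K.filter fun k => k * g' ∈ J).card ≤ M := fun g' =>
    (le_csSup hbdd ⟨g', rfl⟩).trans_eq hg.symm
  have hK0 : (K.card : ℝ≥0∞) ≠ 0 := by simpa using hK.ne_empty
  have hKtop : (K.card : ℝ≥0∞) ≠ ∞ := ENNReal.natCast_ne_top _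
  rw [← ENNReal.le_div_iff_mul_le (Or.inl hK0) (Or.inl hKtop)]
  refine iSup₂_le fun F hF => ?_
  set L : Finset G := insert 1 (K.image fun k => k⁻¹) with hL
  have hlim : Tendsto (fun n => (M : ℝ≥0∞) / K.card +
      ENNReal.ofReal (((boundary (F n) L).ncard : ℝ) / (F n).card)) atTop
      (𝓝 ((M : ℝ≥0∞) / K.card)) := by
    have h := (ENNReal.continuous_ofReal.tendsto 0).comp (hF.2 L (by simp [hL]))
    simpa using tendsto_const_nhds.add h
  rw [← hlim.limsup_eq]
  refine limsup_le_limsup (Eventually.of_forall fun n => ?_)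
  have hFn : 0 < (F n).card := (hF.1 n).card_pos
  have hF0 : ((F n).card : ℝ≥0∞) ≠ 0 := by exact_mod_cast hFn.ne'
  have hFtop : ((F n).card : ℝ≥0∞) ≠ ∞ := ENNReal.natCast_ne_top _
  have hcard : (J ∩ (F n : Set G)).ncard = ((F n).filter (· ∈ J)).card := by
    rw [← Set.ncard_coe_finset]
    congr 1
    ext x; simp [and_comm]
  have key := card_mul_le_of_forall_translate J K (F n) M hM
  rw [← hL] at key
  simp only
  rw [ENNReal.ofReal_div_of_pos (by exact_mod_cast hFn), ENNReal.ofReal_natCast,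
    ENNReal.ofReal_natCast, hcard, ENNReal.div_le_iff hF0 hFtop, add_mul,
    ENNReal.div_mul_cancel hF0 hFtop]
  have key' : (((F n).filter (· ∈ J)).card : ℝ≥0∞) * K.card ≤
      M * (F n).card + (boundary (F n) L).ncard * K.card := by
    rw [mul_comm, mul_comm ((boundary (F n) L).ncard : ℝ≥0∞)]
    exact_mod_cast key
  calc _ ≤ (M * (F n).card + (boundary (F n) L).ncard * K.card : ℝ≥0∞) / K.card :=
        (ENNReal.le_div_iff_mul_le (Or.inl hK0) (Or.inl hKtop)).2 key'
    _ = _ := by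
      rw [ENNReal.add_div, ENNReal.mul_div_cancel_right hK0 hKtop, ENNReal.mul_div_right_comm]

end Density

/-! ### Grids in general position -/

section GenericGrid

open MeasureTheory

variable {n : ℕ}

/-- The projection to a set of coordinates. -/
noncomputable def coordProj (S : Finset (Fin n)) : EuclideanSpace ℝ (Fin n) →ₗ[ℝ] (S → ℝ) :=
  LinearMap.pi fun i : S => (EuclideanSpace.proj i.1 : EuclideanSpace ℝ (Fin n) →L[ℝ] ℝ).toLinearMap

theorem coordProj_apply (S : Finset (Fin n)) (x : EuclideanSpace ℝ (Fin n)) (i : S) :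
    coordProj S x i = x i := rfl

theorem coordProj_surjective (S : Finset (Fin n)) : Function.Surjective (coordProj S) := by
  classical
  intro y
  refine ⟨WithLp.toLp 2 fun i => if h : i ∈ S then y ⟨i, h⟩ else 0, ?_⟩
  funext i
  simp [coordProj_apply]

/-- At most `k + 1` points span affine dimension at most `k`, too small to fill `k + 1` coordinates.
-/
theorem map_coordProj_affineSpan_ne_top {k : ℕ} {s : Finset (EuclideanSpace ℝ (Fin n))}
    (hs : s.card ≤ k + 1) {S : Finset (Fin n)} (hS : S.card = k + 1) :
    (affineSpan ℝ (s : Set (EuclideanSpace ℝ (Fin n)))).map (coordProj S).toAffineMap ≠ ⊤ := by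
  intro h
  have h1 : Module.finrank ℝ ((vectorSpan ℝ (s : Set (EuclideanSpace ℝ (Fin n)))).map
      (coordProj S)) = Module.finrank ℝ (S → ℝ) := by
    have := AffineSubspace.map_direction (coordProj S).toAffineMap
      (affineSpan ℝ (s : Set (EuclideanSpace ℝ (Fin n))))
    rw [h, AffineSubspace.direction_top, direction_affineSpan] at this
    rw [← finrank_top ℝ (S → ℝ), this]
    rfl
  have h2 := Submodule.finrank_map_le (coordProj S)
    (vectorSpan ℝ (s : Set (EuclideanSpace ℝ (Fin n))))
  rcases s.eq_empty_or_nonempty with rfl | hne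
  · rw [Finset.coe_empty, vectorSpan_empty, Submodule.map_bot, finrank_bot,
      Module.finrank_fintype_fun_eq_card, Fintype.card_coe, hS] at h1
    omega
  · have h3 : Module.finrank ℝ (vectorSpan ℝ (s : Set (EuclideanSpace ℝ (Fin n)))) ≤ k := by
      have hc := Nat.sub_add_cancel hne.card_pos
      have := finrank_vectorSpan_image_finset_le ℝ (id : EuclideanSpace ℝ (Fin n) → _) s hc.symm
      rw [Finset.image_id] at this
      omega
    rw [Module.finrank_fintype_fun_eq_card, Fintype.card_coe, hS] at h1
    omega

/-- A generic translate of a grid meets a finite union of `k`-dimensional simplices only in points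
with at most `k` coordinates in the grid. -/
theorem exists_generic_grid {k : ℕ} {𝒮 : Set (Finset (EuclideanSpace ℝ (Fin n)))} (h𝒮 : 𝒮.Finite)
    (hcard : ∀ s ∈ 𝒮, s.card ≤ k + 1) (h : ℝ) :
    ∃ a : EuclideanSpace ℝ (Fin n), ∀ s ∈ 𝒮,
      ∀ x ∈ convexHull ℝ (s : Set (EuclideanSpace ℝ (Fin n))),
        {i | ∃ z : ℤ, x i = a i + h * z}.ncard ≤ k := by
  have hnull : ∀ᵐ a : EuclideanSpace ℝ (Fin n), ∀ s ∈ 𝒮, ∀ S : Finset (Fin n), ∀ z : Fin n → ℤ,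
      S.card = k + 1 → ¬ ∃ x ∈ affineSpan ℝ (s : Set (EuclideanSpace ℝ (Fin n))),
        ∀ i ∈ S, x i = a i + h * z i := by
    rw [ae_ball_iff h𝒮.countable]
    intro s hs
    rw [ae_all_iff]
    intro S
    rw [ae_all_iff]
    intro z
    by_cases hS : S.card = k + 1
    swap
    · simp [hS]
    -- The bad offsets `a`, shifted by the grid vector `b`, lie in this cylinder, a proper affine
    -- subspace and hence a null set; there are only countably many choices of `s`, `S` and `z`.
    set B := ((affineSpan ℝ (s : Set (EuclideanSpace ℝ (Fin n)))).map
      (coordProj S).toAffineMap).comap (coordProj S).toAffineMap with hB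
    have hBtop : B ≠ ⊤ := by
      intro htop
      refine map_coordProj_affineSpan_ne_top (hcard s hs) hS ?_
      rw [eq_top_iff]
      intro y _
      obtain ⟨x, rfl⟩ := coordProj_surjective S y
      have : x ∈ B := htop ▸ AffineSubspace.mem_top _ _ _
      exact this
    have hB0 := Measure.addHaar_affineSubspace (volume : Measure (EuclideanSpace ℝ (Fin n))) B hBtop
    set b : EuclideanSpace ℝ (Fin n) := WithLp.toLp 2 fun i => h * z i
    rw [ae_iff]
    refine measure_mono_null ?_ ((measure_preimage_add_right volume b _).trans hB0)
    intro a ha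
    simp only [hS, forall_const, not_not] at ha
    obtain ⟨x, hx, hxa⟩ := ha
    refine ⟨x, hx, ?_⟩
    funext i
    exact hxa i i.2
  obtain ⟨a, ha⟩ := hnull.exists
  refine ⟨a, fun s hs x hx => ?_⟩
  by_contra! hlt
  obtain ⟨S, hSsub, hScard⟩ := Set.exists_subset_card_eq hlt
  have hSfin : S.Finite := Set.toFinite S
  choose! z hz using fun i (hi : i ∈ S) => hSsub hi
  refine ha s hs hSfin.toFinset z ?_ ⟨x, convexHull_subset_affineSpan _ hx, ?_⟩
  · rw [← Set.ncard_eq_toFinset_card]; exact hScard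
  · intro i hi
    exact hz i (hSfin.mem_toFinset.1 hi)

end GenericGrid

/-! ### Open cells around the faces of the integer grid -/

section GridCell

variable {n : ℕ}

/-- The points that are near the integers `z i` in the coordinates `i ∈ S`, and less so in the other
coordinates. -/
def gridCell (S : Finset (Fin n)) (z : Fin n → ℤ) : Set (Fin n → ℝ) :=
  {y | (∀ i ∈ S, |y i - z i| < 1 / 2) ∧ (∀ l ∉ S, (z l < y l ∧ y l < z l + 1) ∧
    ∀ i ∈ S, |y i - z i| < min (y l - z l) (z l + 1 - y l))}

theorem isOpen_gridCell (S : Finset (Fin n)) (z : Fin n → ℤ) : IsOpen (gridCell S z) := by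
  have e : gridCell S z = (⋂ i ∈ S, {y : Fin n → ℝ | |y i - z i| < 1 / 2}) ∩
      ⋂ l ∈ Sᶜ, (({y : Fin n → ℝ | z l < y l} ∩ {y : Fin n → ℝ | y l < z l + 1}) ∩
        ⋂ i ∈ S, {y : Fin n → ℝ | |y i - z i| < min (y l - z l) (z l + 1 - y l)}) := by
    ext y
    simp [gridCell]
  rw [e]
  refine (isOpen_biInter_finset fun i _ => isOpen_lt (by fun_prop) (by fun_prop)).inter
    (isOpen_biInter_finset fun l _ => ((isOpen_lt (by fun_prop) (by fun_prop)).inter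
      (isOpen_lt (by fun_prop) (by fun_prop))).inter
      (isOpen_biInter_finset fun i _ => isOpen_lt (by fun_prop) (by fun_prop)))

theorem abs_sub_lt_one_of_mem_gridCell {S : Finset (Fin n)} {z : Fin n → ℤ} {y y' : Fin n → ℝ}
    (hy : y ∈ gridCell S z) (hy' : y' ∈ gridCell S z) (i : Fin n) : |y i - y' i| < 1 := by
  by_cases hi : i ∈ S
  · have h1 := abs_lt.1 (hy.1 i hi)
    have h2 := abs_lt.1 (hy'.1 i hi)
    rw [abs_lt]
    constructor <;> linarith [h1.1, h1.2, h2.1, h2.2]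
  · have h1 := (hy.2 i hi).1
    have h2 := (hy'.2 i hi).1
    rw [abs_lt]
    constructor <;> linarith [h1.1, h1.2, h2.1, h2.2]

theorem min_le_abs_sub_intCast (t : ℝ) (a b : ℤ) : min (t - a) (a + 1 - t) ≤ |t - b| := by
  rcases le_or_gt b a with h | h
  · have : (b : ℝ) ≤ a := by exact_mod_cast h
    exact (min_le_left _ _).trans (le_trans (by linarith) (le_abs_self _))
  · have : (a : ℝ) + 1 ≤ b := by exact_mod_cast h
    exact (min_le_right _ _).trans (le_trans (by linarith) (neg_le_abs _))

/-- If `i ∈ S \ S'` and `l ∈ S' \ S`, then `y i` would be strictly closer to the integers than `y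
l`, and conversely. Once `S = S'`, each coordinate determines its integer. -/
theorem gridCell_disjoint {S S' : Finset (Fin n)} {z z' : Fin n → ℤ} {y : Fin n → ℝ}
    (hcard : S.card = S'.card) (hy : y ∈ gridCell S z) (hy' : y ∈ gridCell S' z') :
    S = S' ∧ z = z' := by
  have hSS : S = S' := by
    by_contra hne
    obtain ⟨i, hi, hi'⟩ : ∃ i ∈ S, i ∉ S' := by
      by_contra! h
      exact hne (Finset.eq_of_subset_of_card_le h hcard.ge)
    obtain ⟨l, hl', hl⟩ : ∃ l ∈ S', l ∉ S := by
      by_contra! h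
      exact hne (Finset.eq_of_subset_of_card_le h hcard.le).symm
    have h1 := (hy.2 l hl).2 i hi
    have h2 := (hy'.2 i hi').2 l hl'
    have h3 := min_le_abs_sub_intCast (y i) (z' i) (z i)
    have h4 := min_le_abs_sub_intCast (y l) (z l) (z' l)
    linarith
  subst hSS
  refine ⟨rfl, funext fun i => ?_⟩
  have key : ∀ a b : ℤ, (a : ℝ) < b + 1 → a ≤ b := fun a b h => by
    have : a < b + 1 := by exact_mod_cast h
    omega
  by_cases hi : i ∈ S
  · have h1 := abs_lt.1 (hy.1 i hi)
    have h2 := abs_lt.1 (hy'.1 i hi)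
    exact le_antisymm (key _ _ (by linarith [h1.1, h1.2, h2.1, h2.2]))
      (key _ _ (by linarith [h1.1, h1.2, h2.1, h2.2]))
  · have h1 := (hy.2 i hi).1
    have h2 := (hy'.2 i hi).1
    exact le_antisymm (key _ _ (by linarith [h1.1, h1.2, h2.1, h2.2]))
      (key _ _ (by linarith [h1.1, h1.2, h2.1, h2.2]))

theorem exists_mem_gridCell (y : Fin n → ℝ) :
    ∃ S : Finset (Fin n), S.card = {i | ∃ z : ℤ, y i = z}.ncard ∧ ∃ z, y ∈ gridCell S z := by
  classical
  set S : Finset (Fin n) := Finset.univ.filter fun i => ∃ z : ℤ, y i = z with hS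
  have hz : ∀ i ∈ S, |y i - ⌊y i⌋| = 0 := by
    intro i hi
    obtain ⟨z, hz⟩ := (Finset.mem_filter.1 hi).2
    simp [hz]
  have hfloor : ∀ l ∉ S, (⌊y l⌋ : ℝ) < y l := fun l hl =>
    lt_of_le_of_ne (Int.floor_le _) fun h => hl (by simpa [hS] using ⟨⌊y l⌋, h.symm⟩)
  refine ⟨S, ?_, fun i => ⌊y i⌋, ⟨fun i hi => by rw [hz i hi]; norm_num, fun l hl =>
    ⟨⟨hfloor l hl, Int.lt_floor_add_one _⟩, fun i hi => ?_⟩⟩⟩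
  · rw [← Set.ncard_coe_finset]; simp [hS]
  · rw [hz i hi, lt_min_iff]
    exact ⟨sub_pos.2 (hfloor l hl), sub_pos.2 (Int.lt_floor_add_one _)⟩

end GridCell

/-! ### The dimension of a polyhedron and the cubes in it -/

section Polyhedron

variable {n : ℕ}

theorem isCompact_space {K : Geometry.SimplicialComplex ℝ (EuclideanSpace ℝ (Fin n))}
    (hK : K.faces.Finite) : IsCompact K.space :=
  hK.isCompact_biUnion fun s _ => s.finite_toSet.isCompact_convexHull ℝ

theorem dist_lt_of_abs_sub_le {h δ : ℝ} (hh : 0 ≤ h) (hδ : (n + 1) * h < δ)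
    {x y : EuclideanSpace ℝ (Fin n)} (hxy : ∀ i, |x i - y i| ≤ h) : dist x y < δ := by
  refine lt_of_le_of_lt ?_ hδ
  rw [EuclideanSpace.dist_eq]
  refine Real.sqrt_le_iff.2 ⟨by positivity, ?_⟩
  calc ∑ i, dist (x i) (y i) ^ 2 ≤ ∑ _i : Fin n, h ^ 2 := by
        gcongr with i _
        exact hxy i
    _ = n * h ^ 2 := by simp
    _ ≤ ((n + 1) * h) ^ 2 := by
      rw [mul_pow]
      gcongr
      nlinarith [(Nat.cast_nonneg n : (0 : ℝ) ≤ n)]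

/-- The dimension of a polyhedron is at most the maximal dimension of its simplices. -/
theorem topDim_le_of_card_le {P : Type*} [TopologicalSpace P] {k : ℕ}
    {K : Geometry.SimplicialComplex ℝ (EuclideanSpace ℝ (Fin n))} (hK : K.faces.Finite)
    (hcard : ∀ s ∈ K.faces, s.card ≤ k + 1) (e : P ≃ₜ K.space) : topDim P ≤ k := by
  have : CompactSpace K.space := isCompact_iff_compactSpace.1 (isCompact_space hK)
  have : CompactSpace P := e.symm.compactSpace
  refine iSup₂_le fun α hα => ?_
  obtain ⟨-, hopen, hcov⟩ := hα
  obtain ⟨δ, hδ, hball⟩ := lebesgue_number_lemma_of_metric (isCompact_univ (X := K.space))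
    (c := fun V : α => e.symm ⁻¹' V.1) (fun V => (hopen _ V.2).preimage e.symm.continuous)
    (fun x _ => by
      have : e.symm x ∈ ⋃₀ α := hcov ▸ mem_univ _
      obtain ⟨V, hV, hx⟩ := this
      exact mem_iUnion.2 ⟨⟨V, hV⟩, hx⟩)
  -- The mesh makes `(n + 1) * h < δ`, so each cell lies in a ball of the Lebesgue number, also when
  -- `n = 0`.
  set h : ℝ := δ / (n + 2) with hh
  have hpos : 0 < h := by positivity
  have hlt : (n + 1) * h < δ := by
    rw [hh, mul_div_assoc', div_lt_iff₀ (by positivity)]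
    nlinarith
  obtain ⟨a, ha⟩ := exists_generic_grid hK hcard h
  let y : P → Fin n → ℝ := fun p i => ((e p).1 i - a i) / h
  have hy : Continuous y := by
    refine continuous_pi fun i => ?_
    refine Continuous.div_const (Continuous.sub ?_ continuous_const) _
    exact (EuclideanSpace.proj i : EuclideanSpace ℝ (Fin n) →L[ℝ] ℝ).continuous.comp
      (continuous_subtype_val.comp e.continuous)
  let W : Finset (Fin n) × (Fin n → ℤ) → Set P := fun c => y ⁻¹' gridCell c.1 c.2
  have hW : ∀ c, IsOpen (W c) := fun c => (isOpen_gridCell _ _).preimage hy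
  have hWcov : ∀ p, ∃ c : {c : Finset (Fin n) × (Fin n → ℤ) // c.1.card ≤ k}, p ∈ W c := by
    intro p
    obtain ⟨S, hS, z, hz⟩ := exists_mem_gridCell (y p)
    refine ⟨⟨(S, z), ?_⟩, hz⟩
    obtain ⟨s, hs, hps⟩ := Geometry.SimplicialComplex.mem_space_iff.1 (e p).2
    refine (hS.trans_le ?_).trans (ha s hs _ hps)
    refine Set.ncard_le_ncard ?_ (Set.toFinite _)
    rintro i ⟨z, hz⟩
    refine ⟨z, ?_⟩
    have : ((e p).1 i - a i) / h = z := hz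
    rw [div_eq_iff hpos.ne'] at this
    linarith
  obtain ⟨t, ht⟩ := isCompact_univ.elim_finite_subcover
    (fun c : {c : Finset (Fin n) × (Fin n → ℤ) // c.1.card ≤ k} => W c) (fun c => hW c)
    (fun p _ => mem_iUnion.2 (hWcov p))
  set β : Set (Set P) :=
    (fun c : {c : Finset (Fin n) × (Fin n → ℤ) // c.1.card ≤ k} => W c) ''
      {c | c ∈ t ∧ (W c).Nonempty} with hβ
  have hβcover : IsFiniteOpenCover β := by
    refine ⟨(t.finite_toSet.subset fun c hc => hc.1).image _, ?_, ?_⟩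
    · rintro _ ⟨c, -, rfl⟩
      exact hW c
    · refine eq_univ_of_forall fun p => ?_
      obtain ⟨c, hc, hp⟩ := mem_iUnion₂.1 (ht (mem_univ p))
      exact ⟨W c, ⟨c, ⟨hc, p, hp⟩, rfl⟩, hp⟩
  have hβfine : Finer β α := by
    rintro _ ⟨c, ⟨-, p, hp⟩, rfl⟩
    obtain ⟨V, hV⟩ := hball (e p) (mem_univ _)
    refine ⟨V.1, V.2, fun q hq => ?_⟩
    have hmem : e q ∈ Metric.ball (e p) δ := by
      rw [Metric.mem_ball, Subtype.dist_eq]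
      refine dist_lt_of_abs_sub_le hpos.le hlt fun i => ?_
      have h1 := abs_sub_lt_one_of_mem_gridCell hq hp i
      have h2 : y q i - y p i = ((e q).1 i - (e p).1 i) / h := by
        simp only [y]; ring
      rw [h2, abs_div, abs_of_pos hpos, div_lt_one hpos] at h1
      exact h1.le
    simpa using hV hmem
  refine iInf₂_le_of_le β ⟨hβcover, hβfine⟩ ?_
  have hord : ∀ p : P, {V ∈ β | p ∈ V}.encard ≤ ((k + 1 : ℕ) : ℕ∞) := by
    intro p
    have hc : ∀ V ∈ {V ∈ β | p ∈ V}, ∃ c : Finset (Fin n) × (Fin n → ℤ),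
        c.1.card ≤ k ∧ W c = V := by
      rintro _ ⟨⟨c, -, rfl⟩, -⟩
      exact ⟨c.1, c.2, rfl⟩
    choose! c hck hcW using hc
    have hmaps : MapsTo (fun V => (c V).1.card) {V ∈ β | p ∈ V}
        (Finset.range (k + 1) : Set ℕ) := fun V hV => by
      simpa [Nat.lt_succ_iff] using hck V hV
    -- Cells through `p` with equally many grid coordinates coincide, so at most one remains for
    -- each of the `k + 1` values `0, …, k`.
    have hinj : InjOn (fun V => (c V).1.card) {V ∈ β | p ∈ V} := by
      intro V hV V' hV' heq
      have h1 : p ∈ W (c V) := (hcW V hV).symm ▸ hV.2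
      have h2 : p ∈ W (c V') := (hcW V' hV').symm ▸ hV'.2
      have h3 := gridCell_disjoint heq h1 h2
      rw [← hcW V hV, ← hcW V' hV', Prod.ext h3.1 h3.2]
    refine (Set.encard_le_encard_of_injOn hmaps hinj).trans ?_
    rw [Set.encard_coe_eq_coe_finsetCard, Finset.card_range]
  calc coverOrder β ≤ ((k + 1 : ℕ) : ℕ∞) - 1 := tsub_le_tsub_right (iSup_le hord) 1
    _ = k := by norm_cast

open scoped unitInterval in
/-- A simplex with `k + 1` vertices contains a `k`-cube. -/
theorem exists_cube_subset_convexHull {E : Type*} [NormedAddCommGroup E] [NormedSpace ℝ E] {k : ℕ}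
    {p : Fin (k + 1) → E} (hp : AffineIndependent ℝ p) :
    ∃ ψ : (Fin k → I) → E, Continuous ψ ∧ Function.Injective ψ ∧
      ∀ t, ψ t ∈ convexHull ℝ (range p) := by
  -- Barycentric coordinates: vertex `0` takes the remaining weight, which is nonnegative because
  -- the others add up to at most `k / (k + 1)`.
  let w : (Fin k → I) → Fin (k + 1) → ℝ := fun t =>
    Fin.cons (1 - ∑ i, (t i : ℝ) / (k + 1)) fun i => (t i : ℝ) / (k + 1)
  have hw1 : ∀ t, ∑ j, w t j = 1 := fun t => by simp [w, Fin.sum_univ_succ]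
  have hw0 : ∀ t j, 0 ≤ w t j := by
    intro t j
    refine Fin.cases ?_ (fun i => ?_) j
    · have : ∑ i, (t i : ℝ) / (k + 1) ≤ ∑ _i : Fin k, (1 : ℝ) / (k + 1) := by
        gcongr with i _
        exact (t i).2.2
      have h2 : ∑ _i : Fin k, (1 : ℝ) / (k + 1) ≤ 1 := by
        simp only [Finset.sum_const, Finset.card_univ, Fintype.card_fin, nsmul_eq_mul]
        rw [mul_one_div, div_le_one (by positivity)]
        linarith
      simp only [w, Fin.cons_zero]
      linarith
    · simp only [w, Fin.cons_succ]
      exact div_nonneg (t i).2.1 (by positivity)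
  refine ⟨fun t => ∑ j, w t j • p j, ?_, ?_, fun t => ?_⟩
  · refine continuous_finsetSum _ fun j _ => Continuous.smul ?_ continuous_const
    refine Fin.cases ?_ (fun i => ?_) j
    · simp only [w, Fin.cons_zero]; fun_prop
    · simp only [w, Fin.cons_succ]; fun_prop
  · intro t t' htt
    have h0 := (affineIndependent_iff.1 hp) Finset.univ (fun j => w t j - w t' j)
      (by simp [Finset.sum_sub_distrib, hw1])
      (by simpa [sub_smul, Finset.sum_sub_distrib, sub_eq_zero] using htt)
    funext i
    have := h0 i.succ (Finset.mem_univ _)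
    simp only [w, Fin.cons_succ, sub_eq_zero] at this
    rw [div_left_inj' (by positivity)] at this
    exact Subtype.ext this
  · exact (convex_convexHull ℝ _).sum_mem (fun j _ => hw0 t j) (hw1 t)
      fun j _ => subset_convexHull ℝ _ (mem_range_self j)

open scoped unitInterval in
/-- A nonempty polyhedron contains a cube of its dimension. -/
theorem IsPolyhedron.exists_cube {P : Type*} [TopologicalSpace P] [Nonempty P]
    (hP : IsPolyhedron P) :
    ∃ (k : ℕ) (ψ : (Fin k → I) → P), topDim P ≤ k ∧ Continuous ψ ∧ Function.Injective ψ := by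
  obtain ⟨n, K, hK, ⟨e⟩⟩ := hP
  have hne : K.faces.Nonempty := by
    obtain ⟨s, hs, -⟩ := Geometry.SimplicialComplex.mem_space_iff.1 (e (Classical.arbitrary P)).2
    exact ⟨s, hs⟩
  obtain ⟨s, hs, hmax⟩ := Set.exists_max_image K.faces Finset.card hK hne
  obtain ⟨k, hk⟩ : ∃ k, s.card = k + 1 :=
    ⟨s.card - 1, (Nat.sub_add_cancel (K.nonempty_of_mem_faces hs).card_pos).symm⟩
  let f : Fin (k + 1) ≃ s := (s.equivFinOfCardEq hk).symm
  obtain ⟨ψ, hψ, hinj, hmem⟩ := exists_cube_subset_convexHull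
    ((K.indep hs).comp_embedding f.toEmbedding)
  have hmem' : ∀ t, ψ t ∈ K.space := fun t => by
    refine K.convexHull_subset_space hs (convexHull_mono ?_ (hmem t))
    rintro _ ⟨j, rfl⟩
    exact (f j).2
  refine ⟨k, fun t => e.symm ⟨ψ t, hmem' t⟩, topDim_le_of_card_le hK
    (fun s' hs' => (hmax s' hs').trans hk.le) e, ?_, ?_⟩
  · exact e.symm.continuous.comp (hψ.subtype_mk _)
  · intro t t' h
    exact hinj (congrArg Subtype.val (e.symm.injective h))

end Polyhedron

/-! ### Cubes in the subshift and the lower bound for `dim_ε` -/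

section MeanDimension

open scoped unitInterval

/-- A continuous injective image of a cube keeps opposite faces a definite distance apart. -/
theorem exists_dist_lt_of_opposite {P : Type*} [MetricSpace P] {k : ℕ} {ψ : (Fin k → I) → P}
    (hψ : Continuous ψ) (hinj : Function.Injective ψ) :
    ∃ η > 0, ∀ i s t, s i = 0 → t i = 1 → η < dist (ψ s) (ψ t) := by
  have key : ∀ i, ∃ η > 0, ∀ s t, s i = 0 → t i = 1 → η < dist (ψ s) (ψ t) := by
    intro i
    have hA : ∀ c : I, IsCompact (ψ '' {s | s i = c}) := fun c =>
      ((isClosed_singleton.preimage (continuous_apply i)).isCompact).image hψ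
    have hdisj : Disjoint (ψ '' {s | s i = 0}) (ψ '' {s | s i = 1}) := by
      rw [Set.disjoint_left]
      rintro _ ⟨s, hs, rfl⟩ ⟨t, ht, hts⟩
      obtain rfl := hinj hts
      exact zero_ne_one ((show t i = 0 from hs).symm.trans ht)
    obtain ⟨r, hr, h⟩ := Metric.exists_pos_forall_lt_edist (hA 0) (hA 1).isClosed hdisj
    refine ⟨r, by exact_mod_cast hr, fun s t hs ht => ?_⟩
    have := h _ ⟨s, hs, rfl⟩ _ ⟨t, ht, rfl⟩
    rw [edist_nndist, ENNReal.coe_lt_coe] at this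
    exact_mod_cast this
  choose η hη0 hη using key
  rcases isEmpty_or_nonempty (Fin k) with hk | hk
  · exact ⟨1, one_pos, fun i => isEmptyElim i⟩
  · obtain ⟨j, hj⟩ := Finite.exists_min η
    exact ⟨η j, hη0 j, fun i s t hs ht => (hj i).trans_lt (hη i s t hs ht)⟩

variable {G : Type*} [Group G]

theorem smul_le_orbitDist {X : Type*} [MulAction G X] (d : X → X → ℝ) {F : Finset G} {g : G}
    (hg : g ∈ F) (x y : X) : d (g • x) (g • y) ≤ orbitDist d F x y :=
  le_ciSup (f := fun g : F => d ((g : G) • x) ((g : G) • y)) (Set.finite_range _).bddAbove ⟨g, hg⟩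

theorem continuous_shift {P : Type*} [TopologicalSpace P] (h : G) :
    Continuous (shift h : (G → P) → G → P) :=
  continuous_pi fun g => continuous_apply (g * h)

/-- Points of a subshift that are close for a compatible metric have close coordinates at `1`. -/
theorem Subshift.exists_dist_apply_one_le {P : Type*} [MetricSpace P] [CompactSpace P]
    (X : Subshift G P) (ρ : MetricSpace X.carrier)
    (hρ : ρ.toPseudoMetricSpace.toUniformSpace.toTopologicalSpace = instTopologicalSpaceSubtype)
    {η : ℝ} (hη : 0 < η) :
    ∃ ε > 0, ∀ x y : X.carrier, ρ.dist x y ≤ ε → dist (x.1 1) (y.1 1) ≤ η := by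
  have hcpt : @CompactSpace X.carrier instTopologicalSpaceSubtype :=
    isCompact_iff_compactSpace.1 X.isClosed.isCompact
  have hcont : @Continuous X.carrier P instTopologicalSpaceSubtype _ (fun x => x.1 1) :=
    (continuous_apply (1 : G)).comp continuous_subtype_val
  rw [← hρ] at hcpt hcont
  have huc := @CompactSpace.uniformContinuous_of_continuous _ _
    ρ.toPseudoMetricSpace.toUniformSpace _ hcpt _ hcont
  obtain ⟨ε, hε, h⟩ := (@Metric.uniformContinuous_iff _ _ ρ.toPseudoMetricSpace _ _).1 huc η hη
  exact ⟨ε / 2, half_pos hε, fun x y hxy => (h (lt_of_le_of_lt hxy (half_lt_self hε))).le⟩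

/-- A subshift that contains expanded copies of `P` at the positions in `J` has large `dim_ε` along
every finite set of group elements. -/
theorem Subshift.le_dimEps {P : Type*} [MetricSpace P] [CompactSpace P] (X : Subshift G P)
    {J : Set G} {W : G → Set P} (hWX : Set.pi Set.univ W ⊆ X.carrier)
    {w : G → P} (hw : w ∈ Set.pi Set.univ W) {c : ℝ} (hc : 0 < c)
    (hf : ∀ g ∈ J, ∃ f : C(P, W g), ∀ x y : P, dist x y ≤ c * dist (f x) (f y))
    {ρ : X.carrier → X.carrier → ℝ} {k : ℕ} {ψ : (Fin k → I) → P} (hψ : Continuous ψ)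
    {η : ℝ} (hη : ∀ i s t, s i = 0 → t i = 1 → η < dist (ψ s) (ψ t)) {ε : ℝ}
    (hε : ∀ x y : X.carrier, ρ x y ≤ ε → dist (x.1 1) (y.1 1) ≤ η / c)
    (F : Finset G) (g : G) {A : Finset G} (hAF : A ⊆ F) (hAJ : ∀ a ∈ A, a * g ∈ J) :
    ((k * A.card : ℕ) : ℕ∞) ≤ dimEps (orbitDist ρ F) ε := by
  classical
  choose f hf using hf
  -- Position `a * g` with `a ∈ A` carries its own copy of the cube, sent into `W (a * g)`; all
  -- other positions are frozen at `w`.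
  let pt : (Fin k × A → I) → G → P := fun t h =>
    if hh : h * g⁻¹ ∈ A then
      f h (by simpa using hAJ _ hh) (ψ fun i => t (i, ⟨h * g⁻¹, hh⟩))
    else w h
  have hpt : ∀ t, pt t ∈ Set.pi Set.univ W := by
    intro t h _
    by_cases hh : h * g⁻¹ ∈ A
    · simp only [pt, hh, dif_pos]
      exact Subtype.coe_prop _
    · simp only [pt, hh, dif_neg, not_false_eq_true]
      exact hw h (mem_univ _)
  have hptc : Continuous pt := by
    refine continuous_pi fun h => ?_
    by_cases hh : h * g⁻¹ ∈ A
    · simp only [pt, hh, dif_pos]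
      refine continuous_subtype_val.comp ((f h _).continuous.comp (hψ.comp ?_))
      fun_prop
    · simp only [pt, hh, dif_neg, not_false_eq_true]
      fun_prop
  -- Acting by `g` makes the coordinate at `1` of `a • Φ t` the entry of `pt t` at `a * g`, which
  -- `orbitDist` controls for `a ∈ F`.
  let Φ : (Fin k × A → I) → X.carrier := fun t => g • ⟨pt t, hWX (hpt t)⟩
  have hΦ : Continuous Φ := ((continuous_shift g).comp hptc).subtype_mk _
  have hval : ∀ t, ∀ a : G, (a • Φ t).1 1 = pt t (a * g) := by
    intro t a
    change pt t (1 * a * g) = _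
    rw [one_mul]
  refine le_iInf fun Q => le_iInf fun _ => le_iInf fun _ => le_iInf fun φ => le_iInf fun hφ => ?_
  have hcard : Fintype.card (Fin k × A) = k * A.card := by simp
  rw [← hcard]
  refine natCast_card_le_topDim (φ := φ ∘ Φ) (hφ.1.comp hΦ) ?_
  rintro ⟨i, a⟩ s t hs ht heq
  have h1 := hφ.2 _ _ heq
  have h2 := hε _ _ ((smul_le_orbitDist ρ (hAF a.2) (Φ s) (Φ t)).trans h1)
  rw [hval, hval] at h2
  have haA : a.1 * g * g⁻¹ ∈ A := by simp
  have haJ : a.1 * g ∈ J := hAJ _ a.2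
  have hsub : (⟨a.1 * g * g⁻¹, haA⟩ : A) = a := Subtype.ext (by simp)
  simp only [pt, haA, dif_pos] at h2
  have h3 := hf _ haJ (ψ fun i => s (i, ⟨a.1 * g * g⁻¹, haA⟩))
    (ψ fun i => t (i, ⟨a.1 * g * g⁻¹, haA⟩))
  have h4 := hη i (fun i => s (i, ⟨a.1 * g * g⁻¹, haA⟩)) (fun i => t (i, ⟨a.1 * g * g⁻¹, haA⟩))
    (by simpa only [hsub] using hs) (by simpa only [hsub] using ht)
  have h5 := h3.trans (mul_le_mul_of_nonneg_left h2 hc.le)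
  rw [mul_div_cancel₀ _ hc.ne'] at h5
  linarith

end MeanDimension

end MeanDim

theorem proposition2p10 {G : Type*} [Group G] [Countable G] [Infinite G]
    {P : Type*} [MetricSpace P] (hP : MeanDim.IsPolyhedron P)
    (X : MeanDim.Subshift G P)
    (J : Set G) (x₀ : G → P) (hx₀ : x₀ ∈ X.carrier)
    (W : G → Set P)
    (hWX : Set.pi Set.univ W ⊆ X.carrier)
    (hx₀W : Jᶜ.domRestrict x₀ ∈ Jᶜ.domRestrict '' Set.pi Set.univ W)
    (c : ℝ) (hc : 0 < c)
    (hf : ∀ g ∈ J, ∃ f : C(P, W g), ∀ x y : P, dist x y ≤ c * dist (f x) (f y))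
    -- any metric on `X` that induces its topology, and any Følner sequence of `G`
    (ρ : MetricSpace X.carrier)
    (hρ : ρ.toPseudoMetricSpace.toUniformSpace.toTopologicalSpace = instTopologicalSpaceSubtype)
    (F : ℕ → Finset G) (hF : MeanDim.IsFolner F) :
    MeanDim.upperDensity J * (MeanDim.topDim P : ℝ≥0∞) ≤ MeanDim.mdim ρ.dist F := by
  classical
  have : Nonempty P := ⟨x₀ 1⟩
  have : CompactSpace P := by
    obtain ⟨n, K, hK, ⟨e⟩⟩ := hP
    have := isCompact_iff_compactSpace.1 (MeanDim.isCompact_space hK)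
    exact e.symm.compactSpace
  obtain ⟨w, hw, -⟩ := hx₀W
  obtain ⟨k, ψ, hk, hψ, hinj⟩ := hP.exists_cube
  obtain ⟨η, hη0, hη⟩ := MeanDim.exists_dist_lt_of_opposite hψ hinj
  -- The scale `η / c` absorbs the constant `c`, and `ε` is fixed before `n` is.
  obtain ⟨ε, hε0, hε⟩ := X.exists_dist_apply_one_le ρ hρ (div_pos hη0 hc)
  refine le_trans ?_ (le_iSup₂_of_le ε hε0 le_rfl)
  refine le_liminf_of_le (by isBoundedDefault) (Eventually.of_forall fun n => ?_)
  obtain ⟨g, hg⟩ := MeanDim.exists_upperDensity_mul_card_le J (hF.1 n)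
  have hF0 : ((F n).card : ℝ≥0∞) ≠ 0 := by exact_mod_cast (hF.1 n).card_pos.ne'
  rw [ENNReal.le_div_iff_mul_le (Or.inl hF0) (Or.inl (ENNReal.natCast_ne_top _))]
  have hdim := X.le_dimEps hWX hw hc hf hψ hη hε (F n) g (Finset.filter_subset (fun k => k * g ∈ J) _)
    fun a ha => (Finset.mem_filter.1 ha).2
  have hk' : (MeanDim.topDim P : ℝ≥0∞) ≤ (k : ℝ≥0∞) := by
    exact_mod_cast ENat.toENNReal_le.2 hk
  calc MeanDim.upperDensity J * (MeanDim.topDim P : ℝ≥0∞) * ((F n).card : ℝ≥0∞)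
      = (MeanDim.topDim P : ℝ≥0∞) * (MeanDim.upperDensity J * ((F n).card : ℝ≥0∞)) := by ring
    _ ≤ k * (((F n).filter fun k => k * g ∈ J).card : ℝ≥0∞) := by gcongr
    _ ≤ _ := by exact_mod_cast ENat.toENNReal_le.2 hdim
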